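/- Let $k\ge 1$ and let $\mathcal H=\{h_1,\dots,h_{2k+1}\}$, $h_i=\{x\in\mathbb R^k:\langle n_i,x\rangle=b_i\}$, be an arrangement of $2k+1$ hyperplanes in $\mathbb R^k$ in general position, i.e. any at most $k$ of the normal vectors $n_i$ are linearly independent and any $k+1$ of the hyperplanes have empty intersection. Let $f_{\mathcal H}:\{-1,1\}^{2k+1}\to\{0,1\}$ be the function with $f_{\mathcal H}(s)=1$ if and only if there is an $x\in\mathbb R^k$ with $\mathrm{sign}(\langle x,n_i\rangle-b_i)=s_i$ for all $i$. An $AC^0[p]$ circuit is a boolean circuit (a directed acyclic graph of gates, with inputs in $\{-1,1\}$ read as boolean values, $+1$ as true and $-1$ as false) with unbounded fan-in AND, OR and $\mathrm{MOD}_p$ gates and with negations and constants, where a $\mathrm{MOD}_p$ gate outputs $1$ iff the number of its inputs equal to $1$ is not divisible by $p$; its depth is the largest number of AND, OR and $\mathrm{MOD}_p$ gates on a path from an input to the output, and its size is its number of AND, OR and $\mathrm{MOD}_p$ gates (negations and constants count neither for depth nor for size; the bound then holds a fortiori if they are counted). For every prime $p$ there is a constant $c>0$, depending only on $p$, such that for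 all $d\ge 1$ and $k\ge 1$ and every arrangement $\mathcal H$ of $2k+1$ hyperplanes in general position in $\mathbb R^k$, every $AC^0[p]$ circuit of depth at most $d$ that computes $f_{\mathcal H}$ has at least $\exp\!\left(c\,k^{1/(2d)}\right)$ gates. -/

import Mathlib

/-! ## Hyperplane arrangements and the feasibility function -/

/-- An (indexed) arrangement of `m` hyperplanes `h i = {x : ⟪n i, x⟫ = b i}` in `ℝ^k`, given by
normal vectors and translation scalars. -/
structure HyperplaneArrangement (k m : ℕ) where
  /-- the normal vectors -/
  normal : Fin m → EuclideanSpace ℝ (Fin k)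
  /-- the translation scalars -/
  offset : Fin m → ℝ

namespace HyperplaneArrangement

variable {k m : ℕ}

/-- The `i`-th hyperplane `{x : ⟪n i, x⟫ = b i}`. -/
def hyperplane (H : HyperplaneArrangement k m) (i : Fin m) : Set (EuclideanSpace ℝ (Fin k)) :=
  {x | inner ℝ (H.normal i) x = H.offset i}

/-- General position: any at most `k` of the normal vectors are linearly independent (so any
`j ≤ k` of the hyperplanes meet in an affine subspace of dimension `k - j`), and any `k + 1` of
the hyperplanes have empty intersection. -/
structure InGeneralPosition (H : HyperplaneArrangement k m) : Prop where
  linearIndependent : ∀ I : Finset (Fin m), I.card ≤ k →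
    LinearIndependent ℝ (fun i : I => H.normal i)
  inter_eq_empty : ∀ I : Finset (Fin m), I.card = k + 1 → ⋂ i ∈ I, H.hyperplane i = ∅

/-- Sign patterns in `{-1, 1}^m` are encoded as boolean vectors: `true` is `+1`, `false` is `-1`. -/
def signOfBool (a : Bool) : SignType := if a then 1 else -1

/-- The system encoded by the sign pattern `s` is feasible: some `x` satisfies
`sign (⟪x, n i⟫ - b i) = s i` for all `i`. -/
def Feasible (H : HyperplaneArrangement k m) (s : Fin m → Bool) : Prop :=
  ∃ x : EuclideanSpace ℝ (Fin k), ∀ i : Fin m,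
    SignType.sign (inner ℝ x (H.normal i) - H.offset i) = signOfBool (s i)

open Classical in
/-- The boolean function `f_H`: it is `1` exactly on the feasible sign patterns. -/
noncomputable def feasibilityFn (H : HyperplaneArrangement k m) (s : Fin m → Bool) : Bool :=
  decide (H.Feasible s)

end HyperplaneArrangement

/-! ## Circuits with unbounded fan-in AND, OR, MOD gates and with negations -/

/-- A gate whose inputs are wires from `W`. The fan-in of AND, OR and MOD gates is unbounded, and
the same wire may be used several times. -/
inductive CircuitGate (W : Type) : Type
  | const (a : Bool)
  | not (w : W)
  | and (ws : List W)
  | or (ws : List W)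
  | mod (ws : List W)

namespace CircuitGate

variable {W : Type}

/-- The output of a gate, given the values `v` on the wires. A MOD gate is a `MOD_p` gate: it
outputs `1` iff the number of its inputs that are `1` is not divisible by `p` (since negations are
free, the opposite convention gives the same circuits). -/
def eval (p : ℕ) (v : W → Bool) : CircuitGate W → Bool
  | const a => a
  | not w => !(v w)
  | and ws => ws.all v
  | or ws => ws.any v
  | mod ws => decide (¬ p ∣ ws.countP v)

/-- The depth of a gate, given the depths `δ` of the wires. Negations do not add to the depth. -/
def depth (δ : W → ℕ) : CircuitGate W → ℕ
  | const _ => 0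
  | not w => δ w
  | and ws => (ws.map δ).foldr max 0 + 1
  | or ws => (ws.map δ).foldr max 0 + 1
  | mod ws => (ws.map δ).foldr max 0 + 1

/-- The contribution of a gate to the size: AND, OR and MOD gates count `1`, while constants and
negations are free. -/
def cost : CircuitGate W → ℕ
  | const _ => 0
  | not _ => 0
  | and _ => 1
  | or _ => 1
  | mod _ => 1

end CircuitGate

/-- `CircuitNodes n t`: a directed acyclic graph of `t` gates over `n` input variables, listed in a
topological order. Each new gate may read the input variables and all the earlier gates, and the
output of a gate may be read any number of times. -/
inductive CircuitNodes (n : ℕ) : ℕ → Type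
  | nil : CircuitNodes n 0
  | snoc {t : ℕ} (N : CircuitNodes n t) (g : CircuitGate (Fin n ⊕ Fin t)) : CircuitNodes n (t + 1)

namespace CircuitNodes

variable {n : ℕ}

/-- The value of each gate on the input `x`, where MOD gates are `MOD_p` gates. -/
def val (p : ℕ) (x : Fin n → Bool) : {t : ℕ} → CircuitNodes n t → Fin t → Bool
  | _, nil => Fin.elim0
  | _, snoc N g => Fin.snoc (α := fun _ => Bool) (N.val p x) (g.eval p (Sum.elim x (N.val p x)))

/-- The depth of each gate; input variables have depth `0`. -/
def depth : {t : ℕ} → CircuitNodes n t → Fin t → ℕ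
  | _, nil => Fin.elim0
  | _, snoc N g => Fin.snoc (α := fun _ => ℕ) N.depth (g.depth (Sum.elim (fun _ => 0) N.depth))

/-- The number of AND, OR and MOD gates. -/
def size : {t : ℕ} → CircuitNodes n t → ℕ
  | _, nil => 0
  | _, snoc N g => N.size + g.cost

end CircuitNodes

/-- A boolean circuit with `n` inputs over unbounded fan-in AND, OR, MOD gates and negations: an
acyclic graph of gates together with an output wire. -/
structure ModCircuit (n : ℕ) where
  /-- the number of nodes other than input variables -/
  numNodes : ℕ
  /-- the gates -/
  nodes : CircuitNodes n numNodes
  /-- the output wire: an input variable or a gate -/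
  out : Fin n ⊕ Fin numNodes

namespace ModCircuit

variable {n : ℕ}

/-- The output of the circuit on the input `x`, its MOD gates being read as `MOD_p` gates. -/
def eval (p : ℕ) (C : ModCircuit n) (x : Fin n → Bool) : Bool :=
  Sum.elim x (C.nodes.val p x) C.out

/-- The depth of the circuit: the maximal number of AND, OR and MOD gates on a path from an input
to the output. -/
def depth (C : ModCircuit n) : ℕ := Sum.elim (fun _ => 0) C.nodes.depth C.out

/-- The size of the circuit: its number of AND, OR and MOD gates. -/
def size (C : ModCircuit n) : ℕ := C.nodes.size

/-- The circuit, with `MOD_p` gates, computes the boolean function `f`. -/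
def Computes (p : ℕ) (C : ModCircuit n) (f : (Fin n → Bool) → Bool) : Prop :=
  ∀ x, C.eval p x = f x

end ModCircuit

/-! This is a Razborov–Smolensky argument. General position enters only through one property of
`feasibilityFn`: on any `k + 1` of the `2k + 1` coordinates, each of the values 0 and 1 is excluded
by some sign pattern. Infeasibility is forced by a linear relation among `k + 1` normals
(`exists_infeasible_pattern`). Feasibility is forced near the vertex where the other `k` hyperplanes
meet (`exists_feasible_pattern`).

Hence each level set of `f` satisfies an equation that lowers the degree of every monomial of degree
above `k`, and any function on it is a polynomial of degree at most `k` (`exists_lowDegree_eqOn`).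
If `q` of degree `D` agrees with `f` on `E`, every function on `E` has the form `A * q + B * (1 -
q)` with `A`, `B` of degree at most `k`. Counting dimensions, `E` has at most `4 ^ k + D * (2 * k +
1).choose k` points (`card_agreement_le`), which is at most three quarters of the cube when `D` is a
small multiple of `√k`.

Conversely, a circuit of depth `d` and size `S` agrees with a polynomial over `ZMod p` of degree `(T
* (p - 1)) ^ d` outside a fraction `S / 2 ^ T` of the cube (`ModCircuit.exists_lowDegree_approx`).
So `S ≥ 2 ^ T / 4`, with `T` of order `k ^ (1 / (2 * d))`. When this is too weak, the claimed bound
is at most 2, and one gate is excluded directly (`not_avoidsEdges`). -/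

namespace HyperplaneArrangement

/-! ### Forced infeasible and forced feasible sign patterns -/

variable {k m : ℕ}

/-- The signs on any `k + 1` hyperplanes of `ℝ^k` miss some pattern. -/
theorem exists_infeasible_pattern (H : HyperplaneArrangement k m) (I : Finset (Fin m))
    (hI : I.card = k + 1) :
    ∃ a : Fin m → Bool, ∀ s : Fin m → Bool, (∀ i ∈ I, s i = a i) → ¬ H.Feasible s := by
  classical
  have hdep : ¬ LinearIndependent ℝ (fun i : I => H.normal i) := by
    intro h
    have := h.fintype_card_le_finrank
    simp [hI] at this
  obtain ⟨g, hg, i₀, hi₀⟩ := Fintype.not_linearIndependent_iff.1 hdep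
  have hrel : ∀ x : EuclideanSpace ℝ (Fin k),
      ∑ i : I, g i * (inner ℝ x (H.normal i) - H.offset i) = - ∑ i : I, g i * H.offset i := by
    intro x
    have h0 : ∑ i : I, g i * inner ℝ x (H.normal i) = 0 := by
      have := congrArg (fun y => inner ℝ x y) hg
      simpa only [inner_sum, inner_smul_right, inner_zero_right] using this
    simp only [mul_sub, Finset.sum_sub_distrib, h0, zero_sub]
  -- it suffices to treat relations whose offsets combine to a sum of the right sign
  have key : ∀ g : I → ℝ, (∀ x : EuclideanSpace ℝ (Fin k),
      ∑ i : I, g i * (inner ℝ x (H.normal i) - H.offset i) = - ∑ i : I, g i * H.offset i) →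
      g i₀ ≠ 0 → ∑ i : I, g i * H.offset i ≤ 0 →
      ∃ a : Fin m → Bool, ∀ s : Fin m → Bool, (∀ i ∈ I, s i = a i) → ¬ H.Feasible s := by
    intro g hrel hi₀ hneg
    -- Signs opposite to those of `g` make every term of the relation nonpositive and the `i₀` term
    -- negative, while the total is nonnegative.
    refine ⟨fun i => if h : i ∈ I then decide (g ⟨i, h⟩ < 0) else false, ?_⟩
    rintro s hs ⟨x, hx⟩
    have hterm : ∀ i : I, g i * (inner ℝ x (H.normal i) - H.offset i) ≤ 0 ∧
        (g i ≠ 0 → g i * (inner ℝ x (H.normal i) - H.offset i) < 0) := by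
      intro i
      have h1 := hx i
      rw [hs i i.2] at h1
      simp only [i.2, dif_pos, signOfBool] at h1
      rcases lt_trichotomy (g i) 0 with h | h | h
      · simp only [h, decide_true, if_true, sign_eq_one_iff] at h1
        have := mul_neg_of_neg_of_pos h h1
        exact ⟨this.le, fun _ => this⟩
      · simp [h]
      · simp only [h.not_gt, decide_false, Bool.false_eq_true, if_false, sign_eq_neg_one_iff] at h1
        have := mul_neg_of_pos_of_neg h h1
        exact ⟨this.le, fun _ => this⟩
    have : ∑ i : I, g i * (inner ℝ x (H.normal i) - H.offset i) < 0 :=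
      Finset.sum_neg' (fun i _ => (hterm i).1) ⟨i₀, Finset.mem_univ _, (hterm i₀).2 hi₀⟩
    rw [hrel x] at this
    linarith
  rcases le_total (∑ i : I, g i * H.offset i) 0 with h | h
  · exact key g hrel hi₀ h
  · refine key (fun i => - g i) (fun x => ?_) (neg_ne_zero.2 hi₀) ?_
    · simp only [neg_mul, Finset.sum_neg_distrib, hrel x]
    · simpa only [neg_mul, Finset.sum_neg_distrib, neg_nonpos] using h

/-- Near the common point of `k` hyperplanes all their sign patterns occur, while the signs of the
other hyperplanes are constant. -/
theorem InGeneralPosition.exists_feasible_pattern {H : HyperplaneArrangement k m}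
    (hH : H.InGeneralPosition) (J : Finset (Fin m)) (hJ : J.card = k) :
    ∃ a : Fin m → Bool, ∀ s : Fin m → Bool, (∀ i ∉ J, s i = a i) → H.Feasible s := by
  classical
  have hli := hH.linearIndependent J hJ.le
  have hspan : Submodule.span ℝ (Set.range (fun i : J => H.normal i)) = ⊤ :=
    hli.span_eq_top_of_card_eq_finrank' (by simp [hJ])
  let L : EuclideanSpace ℝ (Fin k) →ₗ[ℝ] (J → ℝ) :=
    LinearMap.pi fun i => (innerₗ (EuclideanSpace ℝ (Fin k)) (H.normal i))
  have hL : ∀ x (i : J), L x i = inner ℝ x (H.normal i) := fun x i => by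
    simp [L, real_inner_comm]
  have hinj : Function.Injective L := by
    rw [← LinearMap.ker_eq_bot, LinearMap.ker_eq_bot']
    intro x hx
    have hx' : x ∈ (Submodule.span ℝ (Set.range (fun i : J => H.normal i)))ᗮ := by
      rw [Submodule.mem_orthogonal]
      intro u hu
      induction hu using Submodule.span_induction with
      | mem u hu =>
        obtain ⟨i, rfl⟩ := hu
        rw [real_inner_comm, ← hL, hx]; rfl
      | zero => simp
      | add u v _ _ hu hv => rw [inner_add_left, hu, hv, add_zero]
      | smul c u _ hu => rw [inner_smul_left, hu, mul_zero]
    simpa [hspan] using hx'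
  have hsurj : Function.Surjective L :=
    (LinearMap.injective_iff_surjective_of_finrank_eq_finrank (by simp [hJ])).1 hinj
  obtain ⟨x₀, hx₀⟩ := hsurj fun i => H.offset i
  have hx₀' : ∀ i ∈ J, inner ℝ x₀ (H.normal i) = H.offset i := fun i hi => by
    rw [← hL x₀ ⟨i, hi⟩, hx₀]
  -- A further hyperplane through the vertex `x₀` would give `k + 1` hyperplanes with a common
  -- point.
  have hne : ∀ i ∉ J, inner ℝ x₀ (H.normal i) - H.offset i ≠ 0 := by
    intro i hi h
    have hempty := hH.inter_eq_empty (insert i J) (by rw [Finset.card_insert_of_notMem hi, hJ])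
    have : x₀ ∈ ⋂ j ∈ insert i J, H.hyperplane j := by
      simp only [Set.mem_iInter, hyperplane, Set.mem_ofPred_eq]
      intro j hj
      rw [real_inner_comm]
      rcases Finset.mem_insert.1 hj with rfl | hj
      · linarith
      · exact hx₀' j hj
    rw [hempty] at this
    exact this
  refine ⟨fun i => decide (0 < inner ℝ x₀ (H.normal i) - H.offset i), fun s hs => ?_⟩
  -- Moving from `x₀` along `v` enters the prescribed side of each hyperplane in `J`; a short move
  -- preserves the other signs.
  obtain ⟨v, hv⟩ := hsurj fun i => if s i then 1 else -1
  have hcont : ∀ i, Filter.Tendsto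
      (fun ε : ℝ => inner ℝ (x₀ + ε • v) (H.normal i) - H.offset i)
      (nhdsWithin 0 (Set.Ioi 0)) (nhds (inner ℝ x₀ (H.normal i) - H.offset i)) := by
    intro i
    have : Continuous fun ε : ℝ => inner ℝ (x₀ + ε • v) (H.normal i) - H.offset i := by
      fun_prop
    simpa using (this.tendsto 0).mono_left nhdsWithin_le_nhds
  have hev : ∀ᶠ ε : ℝ in nhdsWithin 0 (Set.Ioi 0), ∀ i,
      SignType.sign (inner ℝ (x₀ + ε • v) (H.normal i) - H.offset i) = signOfBool (s i) := by
    rw [Filter.eventually_all]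
    intro i
    by_cases hi : i ∈ J
    · filter_upwards [self_mem_nhdsWithin] with ε hε
      have h1 : inner ℝ (x₀ + ε • v) (H.normal i) - H.offset i = ε * (if s i then 1 else -1) := by
        rw [inner_add_left, hx₀' i hi, inner_smul_left, ← hL v ⟨i, hi⟩, hv]
        simp
      rw [h1]
      have hε : 0 < ε := hε
      cases s i <;> simp [signOfBool, hε]
    · rw [hs i hi]
      rcases (hne i hi).lt_or_gt with h | h
      · filter_upwards [(hcont i).eventually_lt_const h] with ε hε
        simp [signOfBool, h.not_gt, sign_neg hε]
      · filter_upwards [(hcont i).eventually_const_lt h] with ε hε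
        simp only [signOfBool, h, decide_true, if_true, sign_pos hε]
  obtain ⟨ε, hε⟩ := hev.exists
  exact ⟨_, hε⟩

end HyperplaneArrangement

/-! ### Low degree polynomials on the cube -/

section LowDegree

variable (F : Type*) [Field F] {n : ℕ}

/-- The value of a boolean in `F`. -/
def boolVal (b : Bool) : F := if b then 1 else 0

/-- The multilinear monomial with index set `I`, as a function on the cube. -/
def cubeMonomial (I : Finset (Fin n)) (x : Fin n → Bool) : F := ∏ i ∈ I, boolVal F (x i)

/-- The functions on the cube given by polynomials of degree at most `D`. -/
def lowDegree (n D : ℕ) : Submodule F ((Fin n → Bool) → F) :=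
  Submodule.span F (cubeMonomial F '' {I | I.card ≤ D})

variable {F}

@[simp] theorem boolVal_true : boolVal F true = 1 := rfl

@[simp] theorem boolVal_false : boolVal F false = 0 := rfl

theorem boolVal_not (b : Bool) : boolVal F (!b) = 1 - boolVal F b := by cases b <;> simp

theorem boolVal_eq_zero {b : Bool} : boolVal F b = 0 ↔ b = false := by cases b <;> simp

/-- Coordinates take the values 0 and 1, hence are idempotent. -/
theorem cubeMonomial_mul (I J : Finset (Fin n)) :
    cubeMonomial F I * cubeMonomial F J = cubeMonomial F (I ∪ J) := by
  funext x
  simp only [Pi.mul_apply, cubeMonomial]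
  by_cases h : ∀ i ∈ I ∪ J, x i = true
  · rw [Finset.prod_eq_one, Finset.prod_eq_one, Finset.prod_eq_one, one_mul] <;>
      intro i hi <;> simp [h i (by simp [hi])]
  · push Not at h
    obtain ⟨i, hi, hx⟩ := h
    have h0 : boolVal F (x i) = 0 := by simp [Bool.eq_false_iff.2 hx]
    rw [Finset.prod_eq_zero hi h0]
    rcases Finset.mem_union.1 hi with hi | hi
    · rw [Finset.prod_eq_zero hi h0, zero_mul]
    · rw [Finset.prod_eq_zero hi h0, mul_zero]

theorem cubeMonomial_mem {D : ℕ} {I : Finset (Fin n)} (h : I.card ≤ D) :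
    cubeMonomial F I ∈ lowDegree F n D :=
  Submodule.subset_span ⟨I, h, rfl⟩

theorem lowDegree_mono {D D' : ℕ} (h : D ≤ D') : lowDegree F n D ≤ lowDegree F n D' :=
  Submodule.span_mono (Set.image_mono fun _ hI => le_trans hI h)

theorem mul_mem_lowDegree {a b : ℕ} {f g : (Fin n → Bool) → F} (hf : f ∈ lowDegree F n a)
    (hg : g ∈ lowDegree F n b) : f * g ∈ lowDegree F n (a + b) := by
  have hle : lowDegree F n a * lowDegree F n b ≤ lowDegree F n (a + b) := by
    rw [lowDegree, lowDegree, Submodule.span_mul_span]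
    refine Submodule.span_le.2 ?_
    rintro _ ⟨_, ⟨I, hI, rfl⟩, _, ⟨J, hJ, rfl⟩, rfl⟩
    simp only [cubeMonomial_mul]
    exact cubeMonomial_mem ((Finset.card_union_le _ _).trans (add_le_add hI hJ))
  exact hle (Submodule.mul_mem_mul hf hg)

theorem one_mem_lowDegree (D : ℕ) : (1 : (Fin n → Bool) → F) ∈ lowDegree F n D := by
  have : (1 : (Fin n → Bool) → F) = cubeMonomial F ∅ := by funext x; simp [cubeMonomial]
  rw [this]
  exact cubeMonomial_mem (by simp)

theorem const_mem_lowDegree (D : ℕ) (c : F) :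
    (fun _ => c : (Fin n → Bool) → F) ∈ lowDegree F n D := by
  have : (fun _ => c : (Fin n → Bool) → F) = c • 1 := by funext x; simp
  rw [this]
  exact Submodule.smul_mem _ _ (one_mem_lowDegree D)

theorem coord_mem_lowDegree {D : ℕ} (hD : 1 ≤ D) (i : Fin n) :
    (fun x => boolVal F (x i) : (Fin n → Bool) → F) ∈ lowDegree F n D := by
  have : (fun x => boolVal F (x i) : (Fin n → Bool) → F) = cubeMonomial F {i} := by
    funext x; simp [cubeMonomial]
  rw [this]
  exact cubeMonomial_mem (by simpa using hD)

theorem pow_mem_lowDegree {a : ℕ} {f : (Fin n → Bool) → F} (hf : f ∈ lowDegree F n a) (r : ℕ) :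
    f ^ r ∈ lowDegree F n (r * a) := by
  induction r with
  | zero => simpa using one_mem_lowDegree 0
  | succ r ih => rw [pow_succ, Nat.succ_mul]; exact mul_mem_lowDegree ih hf

theorem prod_mem_lowDegree {ι : Type*} (s : Finset ι) (f : ι → (Fin n → Bool) → F)
    (hf : ∀ i ∈ s, f i ∈ lowDegree F n 1) : ∏ i ∈ s, f i ∈ lowDegree F n s.card := by
  classical
  induction s using Finset.induction_on with
  | empty => simpa using one_mem_lowDegree 0
  | insert a s ha ih =>
    rw [Finset.prod_insert ha, Finset.card_insert_of_notMem ha, add_comm]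
    exact mul_mem_lowDegree (hf a (by simp)) (ih fun i hi => hf i (by simp [hi]))

theorem mem_lowDegree_dimension (g : (Fin n → Bool) → F) : g ∈ lowDegree F n n := by
  -- Interpolation: the product is the indicator of the point `a`.
  have hg : g = ∑ a, g a • ∏ i : Fin n, (fun x : Fin n → Bool =>
      if a i then boolVal F (x i) else 1 - boolVal F (x i)) := by
    funext x
    rw [Finset.sum_apply, Finset.sum_eq_single x]
    · rw [Pi.smul_apply, Finset.prod_apply, Finset.prod_eq_one]
      · simp
      · intro i _
        cases x i <;> simp
    · intro a _ hax
      obtain ⟨i, hi⟩ := Function.ne_iff.1 hax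
      rw [Pi.smul_apply, Finset.prod_apply, Finset.prod_eq_zero (Finset.mem_univ i), smul_zero]
      revert hi
      cases a i <;> cases x i <;> simp
    · simp
  rw [hg]
  refine Submodule.sum_mem _ fun a _ => Submodule.smul_mem _ _ ?_
  have := prod_mem_lowDegree (F := F) (Finset.univ : Finset (Fin n)) (fun i x =>
      if a i then boolVal F (x i) else 1 - boolVal F (x i)) (fun i _ => ?_)
  · simpa using this
  · cases a i
    · exact Submodule.sub_mem _ (one_mem_lowDegree 1) (coord_mem_lowDegree le_rfl i)
    · exact coord_mem_lowDegree le_rfl i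

/-- If the projection of `T` to any `k + 1` coordinates is not onto, then every function on `T` is
given by a polynomial of degree at most `k`. -/
theorem exists_lowDegree_eqOn {k : ℕ} (T : Set (Fin n → Bool))
    (hT : ∀ I : Finset (Fin n), I.card = k + 1 →
      ∃ a : Fin n → Bool, ∀ s, (∀ i ∈ I, s i = a i) → s ∉ T)
    (g : (Fin n → Bool) → F) : ∃ q ∈ lowDegree F n k, Set.EqOn q g T := by
  classical
  have hmono : ∀ D, k ≤ D → ∀ I : Finset (Fin n), I.card ≤ D + 1 →
      ∃ q ∈ lowDegree F n D, Set.EqOn q (cubeMonomial F I) T := by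
    intro D hkD I hI
    rcases Nat.lt_or_ge D I.card with h | h
    swap
    · exact ⟨_, cubeMonomial_mem h, fun _ _ => rfl⟩
    obtain ⟨I', hI', hcard⟩ := Finset.exists_subset_card_eq (show k + 1 ≤ I.card by omega)
    obtain ⟨a, ha⟩ := hT I' hcard
    -- On `T` some coordinate in `I'` differs from `a`, so `∏ i ∈ I', (x i - (1 - a i))` vanishes
    -- there. Expanding it, the top monomial equals minus the remaining terms `r`, of degree at most
    -- `k`.
    let r : (Fin n → Bool) → F := ∑ t ∈ I'.powerset.erase I',
      (∏ i ∈ I' \ t, - boolVal F (!(a i))) • cubeMonomial F t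
    have hr : r ∈ lowDegree F n k := by
      refine Submodule.sum_mem _ fun t ht => Submodule.smul_mem _ _ (cubeMonomial_mem ?_)
      rw [Finset.mem_erase, Finset.mem_powerset] at ht
      have := Finset.card_lt_card (ht.2.ssubset_of_ne ht.1)
      omega
    have hP : ∀ x ∈ T, cubeMonomial F I' x = - r x := by
      intro x hx
      have h0 : ∏ i ∈ I', (boolVal F (x i) + - boolVal F (!(a i))) = 0 := by
        by_contra hne
        refine ha x (fun i hi => ?_) hx
        by_contra hxa
        refine hne (Finset.prod_eq_zero hi ?_)
        revert hxa
        cases x i <;> cases a i <;> simp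
      rw [Finset.prod_add, ← Finset.add_sum_erase _ _ (Finset.mem_powerset_self I')] at h0
      simp only [Finset.sdiff_self, Finset.prod_empty, mul_one] at h0
      rw [eq_neg_iff_add_eq_zero, ← h0]
      simp only [r, cubeMonomial, Finset.sum_apply, Pi.smul_apply, smul_eq_mul, mul_comm]
    refine ⟨-r * cubeMonomial F (I \ I'), ?_, ?_⟩
    · refine lowDegree_mono ?_ (mul_mem_lowDegree (Submodule.neg_mem _ hr)
        (cubeMonomial_mem (le_refl _)))
      rw [Finset.card_sdiff_of_subset hI']
      omega
    · intro x hx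
      have hu : I' ∪ (I \ I') = I := Finset.union_sdiff_of_subset hI'
      calc (-r * cubeMonomial F (I \ I')) x
          = (cubeMonomial F I' * cubeMonomial F (I \ I')) x := by simp [hP x hx]
        _ = cubeMonomial F I x := by rw [cubeMonomial_mul, hu]
  have hstep : ∀ D, k ≤ D → ∀ q ∈ lowDegree F n (D + 1), ∃ q' ∈ lowDegree F n D,
      Set.EqOn q' q T := by
    intro D hD q hq
    induction hq using Submodule.span_induction with
    | mem q hq => obtain ⟨I, hI, rfl⟩ := hq; exact hmono D hD I hI
    | zero => exact ⟨0, Submodule.zero_mem _, fun _ _ => rfl⟩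
    | add u v _ _ hu hv =>
      obtain ⟨u', hu', hu⟩ := hu
      obtain ⟨v', hv', hv⟩ := hv
      exact ⟨u' + v', Submodule.add_mem _ hu' hv', fun x hx => by simp [hu hx, hv hx]⟩
    | smul c u _ hu =>
      obtain ⟨u', hu', hu⟩ := hu
      exact ⟨c • u', Submodule.smul_mem _ _ hu', fun x hx => by simp [hu hx]⟩
  have hall : ∀ j, ∀ q ∈ lowDegree F n (k + j), ∃ q' ∈ lowDegree F n k, Set.EqOn q' q T := by
    intro j
    induction j with
    | zero => exact fun q hq => ⟨q, hq, fun _ _ => rfl⟩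
    | succ j ih =>
      intro q hq
      obtain ⟨q₁, hq₁, h₁⟩ := hstep (k + j) (by omega) q hq
      obtain ⟨q₂, hq₂, h₂⟩ := ih q₁ hq₁
      exact ⟨q₂, hq₂, h₂.trans h₁⟩
  exact hall n g (lowDegree_mono (by omega) (mem_lowDegree_dimension g))

/-! ### Dimension count and binomial estimates -/

theorem finrank_lowDegree_le (n D : ℕ) :
    Module.finrank F (lowDegree F n D) ≤ ∑ i ∈ Finset.range (D + 1), n.choose i := by
  classical
  have hset : cubeMonomial F '' {I : Finset (Fin n) | I.card ≤ D} =
      ((((Finset.range (D + 1)).biUnion fun i =>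
        (Finset.univ : Finset (Fin n)).powersetCard i).image (cubeMonomial F) : Finset _) :
          Set ((Fin n → Bool) → F)) := by
    ext q
    simp
  rw [lowDegree, hset]
  refine (finrank_span_finset_le_card _).trans (Finset.card_image_le.trans
    (Finset.card_biUnion_le.trans (le_of_eq ?_)))
  simp

/-- The first `k + 1` binomials of the odd row fill half the cube; each of the next `D` is at most
the middle one. -/
theorem sum_choose_le (k D : ℕ) :
    ∑ i ∈ Finset.range (k + D + 1), (2 * k + 1).choose i ≤ 4 ^ k + D * (2 * k + 1).choose k := by
  rw [show k + D + 1 = (k + 1) + D by ring, Finset.sum_range_add,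
    Nat.sum_range_choose_halfway]
  refine Nat.add_le_add_left ?_ _
  conv_rhs => rw [← Finset.card_range D, ← smul_eq_mul]
  refine Finset.sum_le_card_nsmul _ _ _ fun i _ => ?_
  simpa [show (2 * k + 1) / 2 = k by omega] using Nat.choose_le_middle (k + 1 + i) (2 * k + 1)

theorem centralBinom_sq_le (m : ℕ) : Nat.centralBinom m ^ 2 * (2 * m + 1) ≤ 16 ^ m := by
  induction m with
  | zero => simp
  | succ m ih =>
    have h := Nat.succ_mul_centralBinom_succ m
    refine Nat.le_of_mul_le_mul_left (?_ : (m + 1) ^ 2 * _ ≤ (m + 1) ^ 2 * _) (by positivity)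
    calc (m + 1) ^ 2 * (Nat.centralBinom (m + 1) ^ 2 * (2 * (m + 1) + 1))
        = ((m + 1) * Nat.centralBinom (m + 1)) ^ 2 * (2 * m + 3) := by ring
      _ = (Nat.centralBinom m ^ 2 * (2 * m + 1)) * (4 * (2 * m + 1) * (2 * m + 3)) := by
        rw [h]; ring
      -- This is `(2m + 1)(2m + 3) ≤ (2m + 2)²`.
      _ ≤ 16 ^ m * (16 * (m + 1) ^ 2) := Nat.mul_le_mul ih (by nlinarith)
      _ = (m + 1) ^ 2 * 16 ^ (m + 1) := by ring

/-- For `D` of order `√k`, the surplus over half the cube is at most a quarter of it. -/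
theorem four_mul_choose_le {k D : ℕ} (hD : (4 * D) ^ 2 ≤ 2 * k + 3) :
    4 * (D * (2 * k + 1).choose k) ≤ 2 ^ (2 * k + 1) := by
  have h2 : Nat.centralBinom (k + 1) = 2 * (2 * k + 1).choose k := by
    rw [Nat.centralBinom_eq_two_mul_choose, show 2 * (k + 1) = (2 * k + 1) + 1 by ring,
      show (2 * k + 1 + 1).choose (k + 1) =
        (2 * k + 1).choose k + (2 * k + 1).choose (k + 1) from Nat.choose_succ_succ _ _,
      Nat.choose_symm_half, ← two_mul]
  have h := centralBinom_sq_le (k + 1)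
  rw [h2] at h
  refine (Nat.pow_le_pow_iff_left (two_ne_zero)).1 ?_
  calc (4 * (D * (2 * k + 1).choose k)) ^ 2
      = (4 * D) ^ 2 * ((2 * k + 1).choose k) ^ 2 := by ring
    _ ≤ (2 * k + 3) * ((2 * k + 1).choose k) ^ 2 := Nat.mul_le_mul_right _ hD
    _ ≤ 4 * 16 ^ k := by
      rw [pow_succ 16] at h
      nlinarith
    _ = (2 ^ (2 * k + 1)) ^ 2 := by
      rw [← pow_mul, show (2 * k + 1) * 2 = 2 + 4 * k by ring, pow_add, pow_mul]
      norm_num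

/-- A boolean function of `2 k + 1` variables both of whose level sets miss a pattern on any `k + 1`
coordinates is far from the polynomials of low degree. -/
theorem card_agreement_le {k D : ℕ} (f : (Fin (2 * k + 1) → Bool) → Bool)
    (hf : ∀ b, ∀ I : Finset (Fin (2 * k + 1)), I.card = k + 1 →
      ∃ a : Fin (2 * k + 1) → Bool, ∀ s, (∀ i ∈ I, s i = a i) → f s ≠ b)
    {q : (Fin (2 * k + 1) → Bool) → F} (hq : q ∈ lowDegree F (2 * k + 1) D)
    (E : Finset (Fin (2 * k + 1) → Bool)) (hE : ∀ x ∈ E, q x = boolVal F (f x)) :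
    E.card ≤ 4 ^ k + D * (2 * k + 1).choose k := by
  classical
  let ρ : lowDegree F (2 * k + 1) (k + D) →ₗ[F] (E → F) :=
    (LinearMap.funLeft F F (fun x : E => (x : Fin (2 * k + 1) → Bool))).comp (Submodule.subtype _)
  have hρ : Function.Surjective ρ := by
    intro g
    let g' : (Fin (2 * k + 1) → Bool) → F := fun x => if h : x ∈ E then g ⟨x, h⟩ else 0
    -- On `E` the polynomial `q` is the indicator of `f = true`, so it glues the two low degree
    -- representatives of `g`.
    obtain ⟨A, hA, hAg⟩ := exists_lowDegree_eqOn {x | f x = true} (hf true) g'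
    obtain ⟨B, hB, hBg⟩ := exists_lowDegree_eqOn {x | f x = false} (hf false) g'
    refine ⟨⟨A * q + B * (1 - q), Submodule.add_mem _ (mul_mem_lowDegree hA hq)
      (mul_mem_lowDegree hB (Submodule.sub_mem _ (one_mem_lowDegree D) hq))⟩, ?_⟩
    funext x
    have hx : g x = g' x := by simp [g']
    have h1 : ρ ⟨A * q + B * (1 - q), Submodule.add_mem _ (mul_mem_lowDegree hA hq)
      (mul_mem_lowDegree hB (Submodule.sub_mem _ (one_mem_lowDegree D) hq))⟩ x =
        A x * q x + B x * (1 - q x) := rfl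
    rw [h1, hE x x.2, hx]
    cases hfx : f x
    · simp [hBg hfx]
    · simp [hAg hfx]
  have := LinearMap.finrank_le_finrank_of_surjective hρ
  rw [Module.finrank_fintype_fun_eq_card, Fintype.card_coe] at this
  exact this.trans ((finrank_lowDegree_le _ _).trans (sum_choose_le k D))

end LowDegree

/-! ### Approximation of circuits by polynomials over `ZMod p` -/

section Approximation

/-- Adding 1 to a coefficient `r w` with `v w ≠ 0` injects the solutions into the non-solutions. -/
theorem two_mul_card_sum_mul_eq_zero_le {F W : Type*} [Field F] [Fintype F] [DecidableEq F]
    [Fintype W] [DecidableEq W] (s : Finset W) (v : W → F) (hv : ∃ w ∈ s, v w ≠ 0) :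
    2 * (Finset.univ.filter fun r : W → F => ∑ w ∈ s, r w * v w = 0).card ≤
      Fintype.card (W → F) := by
  obtain ⟨w, hw, hne⟩ := hv
  have hinj : (Finset.univ.filter fun r : W → F => ∑ w ∈ s, r w * v w = 0).card ≤
      (Finset.univ.filter fun r : W → F => ¬ ∑ w ∈ s, r w * v w = 0).card := by
    refine Finset.card_le_card_of_injOn (fun r => r + Pi.single w 1) ?_
      (fun r _ r' _ h => add_right_cancel h)
    intro r hr
    simp only [Finset.coe_filter, Finset.mem_univ, true_and, Set.mem_ofPred_eq] at hr ⊢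
    simp only [Pi.add_apply, add_mul, Finset.sum_add_distrib, hr, zero_add]
    rw [Finset.sum_eq_single_of_mem w hw]
    · simpa using hne
    · intro b _ hb
      simp [hb]
  have hsum := Finset.card_filter_add_card_filter_not (s := (Finset.univ : Finset (W → F)))
    (fun r => ∑ w ∈ s, r w * v w = 0)
  rw [Finset.card_univ] at hsum
  rw [← hsum, two_mul]
  exact Nat.add_le_add_left hinj _

/-- Average the previous bound over `B`: some choice of coefficients does at least as well as the
mean. -/
theorem exists_linearCombination {F α W : Type*} [Field F] [Fintype F] [DecidableEq F]
    [Fintype W] [DecidableEq W] (B : Finset α) (s : Finset W) (v : W → α → F)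
    (hv : ∀ x ∈ B, ∃ w ∈ s, v w x ≠ 0) :
    ∃ r : W → F, 2 * (B.filter fun x => ∑ w ∈ s, r w * v w x = 0).card ≤ B.card := by
  have h2 : ∑ r : W → F, (B.filter fun x => ∑ w ∈ s, r w * v w x = 0).card =
      ∑ x ∈ B, (Finset.univ.filter fun r : W → F => ∑ w ∈ s, r w * v w x = 0).card :=
    Finset.sum_card_bipartiteAbove_eq_sum_card_bipartiteBelow
      (fun (r : W → F) x => ∑ w ∈ s, r w * v w x = 0)
  have h3 := Finset.sum_le_sum fun x hx =>
    two_mul_card_sum_mul_eq_zero_le s (fun w => v w x) (hv x hx)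
  obtain ⟨r, -, hr⟩ := Finset.exists_le_of_sum_le (s := (Finset.univ : Finset (W → F)))
    (f := fun r => 2 * (B.filter fun x => ∑ w ∈ s, r w * v w x = 0).card)
    (g := fun _ => B.card) Finset.univ_nonempty (by
      rw [← Finset.mul_sum, h2, Finset.mul_sum]
      refine h3.trans (le_of_eq ?_)
      rw [Finset.sum_const, Finset.sum_const, smul_eq_mul, smul_eq_mul, Finset.card_univ,
        mul_comm])
  exact ⟨r, hr⟩

variable {p : ℕ} [Fact p.Prime] {n : ℕ}

/-- A low degree approximation to the NOR of the conditions `q w ≠ 0`, `w ∈ s`. -/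
theorem exists_lowDegree_nor {W : Type*} [Fintype W] [DecidableEq W] (s : Finset W)
    (q : W → (Fin n → Bool) → ZMod p) (e : ℕ) (hq : ∀ w ∈ s, q w ∈ lowDegree (ZMod p) n e)
    (T : ℕ) :
    ∃ Z ∈ lowDegree (ZMod p) n (T * ((p - 1) * e)),
      (∀ x, (∀ w ∈ s, q w x = 0) → Z x = 1) ∧
      (Finset.univ.filter fun x => (∃ w ∈ s, q w x ≠ 0) ∧ Z x ≠ 0).card * 2 ^ T ≤ 2 ^ n := by
  have hp : p - 1 ≠ 0 := by have := (Fact.out : p.Prime).two_le; omega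
  induction T with
  | zero =>
    refine ⟨1, one_mem_lowDegree _, fun _ _ => rfl, ?_⟩
    simpa using Finset.card_filter_le (Finset.univ : Finset (Fin n → Bool)) _
  | succ T ih =>
    obtain ⟨Z, hZ, h1, h2⟩ := ih
    obtain ⟨r, hr⟩ := exists_linearCombination
      (Finset.univ.filter fun x => (∃ w ∈ s, q w x ≠ 0) ∧ Z x ≠ 0) s q
      (fun x hx => ((Finset.mem_filter.1 hx).2).1)
    have hl : ∑ w ∈ s, r w • q w ∈ lowDegree (ZMod p) n e :=
      Submodule.sum_mem _ fun w hw => Submodule.smul_mem _ _ (hq w hw)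
    have hval : ∀ x, (∑ w ∈ s, r w • q w) x = ∑ w ∈ s, r w * q w x := fun x => by
      simp [Finset.sum_apply]
    -- By Fermat the new factor vanishes wherever the linear combination is nonzero, and `r` was
    -- chosen so that this removes at least half of the surviving errors.
    refine ⟨Z * (1 - (∑ w ∈ s, r w • q w) ^ (p - 1)), ?_, ?_, ?_⟩
    · rw [Nat.succ_mul]
      exact mul_mem_lowDegree hZ (Submodule.sub_mem _ (one_mem_lowDegree _)
        (pow_mem_lowDegree hl _))
    · intro x hx
      have h0 : ∑ w ∈ s, r w * q w x = 0 := Finset.sum_eq_zero fun w hw => by simp [hx w hw]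
      simp only [Pi.mul_apply, Pi.sub_apply, Pi.one_apply, Pi.pow_apply, hval, h0, h1 x hx,
        zero_pow hp, sub_zero, mul_one]
    · have hsub : (Finset.univ.filter fun x => (∃ w ∈ s, q w x ≠ 0) ∧
          (Z * (1 - (∑ w ∈ s, r w • q w) ^ (p - 1))) x ≠ 0) ⊆
          (Finset.univ.filter fun x => (∃ w ∈ s, q w x ≠ 0) ∧ Z x ≠ 0).filter
            fun x => ∑ w ∈ s, r w * q w x = 0 := by
        intro x
        simp only [Finset.mem_filter, Finset.mem_univ, true_and, Pi.mul_apply, Pi.sub_apply,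
          Pi.one_apply, Pi.pow_apply, hval]
        rintro ⟨hx, hne⟩
        refine ⟨⟨hx, left_ne_zero_of_mul hne⟩, ?_⟩
        by_contra h0
        exact right_ne_zero_of_mul hne (by rw [ZMod.pow_card_sub_one_eq_one h0, sub_self])
      have hcard := Finset.card_le_card hsub
      rw [pow_succ']
      nlinarith [Nat.two_pow_pos T]

theorem le_foldr_max {W : Type*} (δ : W → ℕ) {ws : List W} {w : W} (hw : w ∈ ws) :
    δ w ≤ (ws.map δ).foldr max 0 := by
  induction ws with
  | nil => simp at hw
  | cons a l ih =>
    rcases List.mem_cons.1 hw with rfl | h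
    · simp
    · simp [ih h]

theorem sum_boolVal_eq_countP {F W : Type*} [Field F] (v : W → Bool) (ws : List W) :
    (ws.map fun w => boolVal F (v w)).sum = (ws.countP v : F) := by
  induction ws with
  | nil => simp
  | cons a l ih =>
    rw [List.map_cons, List.sum_cons, ih, List.countP_cons]
    cases v a <;> simp [add_comm]

theorem listSum_mem_lowDegree {F W : Type*} [Field F] (q : W → (Fin n → Bool) → F) (e : ℕ)
    (ws : List W) (hq : ∀ w ∈ ws, q w ∈ lowDegree F n e) :
    (fun x => (ws.map fun w => q w x).sum) ∈ lowDegree F n e := by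
  induction ws with
  | nil => exact Submodule.zero_mem _
  | cons a l ih =>
    exact Submodule.add_mem _ (hq a (by simp)) (ih fun w hw => hq w (by simp [hw]))

/-- A gate whose wires carry low degree polynomials is approximated by a polynomial that errs on
few of the inputs on which all the wires are right. -/
theorem CircuitGate.exists_lowDegree_approx {W : Type} [Fintype W] [DecidableEq W] (g : CircuitGate W)
    (v : (Fin n → Bool) → W → Bool) (δ : W → ℕ) (q : W → (Fin n → Bool) → ZMod p) (T : ℕ)
    (hT : 1 ≤ T) (hq : ∀ w, q w ∈ lowDegree (ZMod p) n ((T * (p - 1)) ^ δ w)) :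
    ∃ r ∈ lowDegree (ZMod p) n ((T * (p - 1)) ^ g.depth δ),
      (Finset.univ.filter fun x => (∀ w, q w x = boolVal (ZMod p) (v x w)) ∧
        r x ≠ boolVal (ZMod p) (g.eval p (v x))).card * 2 ^ T ≤ g.cost * 2 ^ n := by
  have hp : 0 < p - 1 := by have := (Fact.out : p.Prime).two_le; omega
  have hM : 0 < T * (p - 1) := Nat.mul_pos hT hp
  have hmem : ∀ ws : List W, ∀ w ∈ ws,
      q w ∈ lowDegree (ZMod p) n ((T * (p - 1)) ^ (ws.map δ).foldr max 0) := fun ws w hw =>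
    lowDegree_mono (Nat.pow_le_pow_right hM (le_foldr_max δ hw)) (hq w)
  have hdeg : ∀ e : ℕ, T * ((p - 1) * (T * (p - 1)) ^ e) = (T * (p - 1)) ^ (e + 1) := fun e => by
    rw [pow_succ]; ring
  have exact_case : ∀ (r : (Fin n → Bool) → ZMod p) (c : ℕ), (∀ x,
      (∀ w, q w x = boolVal (ZMod p) (v x w)) → r x = boolVal (ZMod p) (g.eval p (v x))) →
      (Finset.univ.filter fun x => (∀ w, q w x = boolVal (ZMod p) (v x w)) ∧
        r x ≠ boolVal (ZMod p) (g.eval p (v x))).card * 2 ^ T ≤ c * 2 ^ n := by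
    intro r c h
    rw [Finset.filter_false_of_mem]
    · simp
    · rintro x _ ⟨h1, h2⟩
      exact h2 (h x h1)
  cases g with
  | const a => exact ⟨_, const_mem_lowDegree _ (boolVal (ZMod p) a), exact_case _ _ fun _ _ => rfl⟩
  | not w =>
    refine ⟨1 - q w, Submodule.sub_mem _ (one_mem_lowDegree _) (hq w), exact_case _ _ ?_⟩
    intro x hx
    simp [CircuitGate.eval, boolVal_not, hx]
  | and ws =>
    -- AND is the NOR of the negated inputs.
    obtain ⟨Z, hZ, h1, h2⟩ := exists_lowDegree_nor ws.toFinset (fun w => 1 - q w) _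
      (fun w hw => Submodule.sub_mem _ (one_mem_lowDegree _)
        (hmem ws w (List.mem_toFinset.1 hw))) T
    rw [hdeg] at hZ
    refine ⟨Z, hZ, ?_⟩
    rw [CircuitGate.cost, one_mul]
    refine (Nat.mul_le_mul_right _ (Finset.card_le_card fun x => ?_)).trans h2
    simp only [Finset.mem_filter, Finset.mem_univ, true_and, List.mem_toFinset]
    rintro ⟨hx, hne⟩
    have hex : ∃ w ∈ ws, (1 - q w) x ≠ 0 := by
      by_contra hcon
      push Not at hcon
      refine hne ?_
      rw [h1 x (fun w hw => hcon w (List.mem_toFinset.1 hw))]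
      have : ws.all (v x) = true := by
        rw [List.all_eq_true]
        intro w hw
        have h := hcon w hw
        rw [Pi.sub_apply, Pi.one_apply, hx w, ← boolVal_not, boolVal_eq_zero] at h
        simpa using h
      simp [CircuitGate.eval, this]
    refine ⟨hex, fun h0 => hne ?_⟩
    obtain ⟨w, hw, hwx⟩ := hex
    rw [Pi.sub_apply, Pi.one_apply, hx w, ← boolVal_not, Ne, boolVal_eq_zero] at hwx
    have : ws.all (v x) = false := List.all_eq_false.2 ⟨w, hw, by simpa using hwx⟩
    simp [CircuitGate.eval, this, h0]
  | or ws =>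
    obtain ⟨Z, hZ, h1, h2⟩ := exists_lowDegree_nor ws.toFinset q _
      (fun w hw => hmem ws w (List.mem_toFinset.1 hw)) T
    rw [hdeg] at hZ
    refine ⟨1 - Z, Submodule.sub_mem _ (one_mem_lowDegree _) hZ, ?_⟩
    rw [CircuitGate.cost, one_mul]
    refine (Nat.mul_le_mul_right _ (Finset.card_le_card fun x => ?_)).trans h2
    simp only [Finset.mem_filter, Finset.mem_univ, true_and, List.mem_toFinset]
    rintro ⟨hx, hne⟩
    have hex : ∃ w ∈ ws, q w x ≠ 0 := by
      by_contra hcon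
      push Not at hcon
      refine hne ?_
      have : ws.any (v x) = false := by
        rw [List.any_eq_false]
        intro w hw
        have h := hcon w hw
        rw [hx w, boolVal_eq_zero] at h
        simpa using h
      simp [CircuitGate.eval, this, h1 x (fun w hw => hcon w (List.mem_toFinset.1 hw))]
    refine ⟨hex, fun h0 => hne ?_⟩
    obtain ⟨w, hw, hwx⟩ := hex
    rw [hx w, Ne, boolVal_eq_zero] at hwx
    have : ws.any (v x) = true := List.any_eq_true.2 ⟨w, hw, by simpa using hwx⟩
    simp [CircuitGate.eval, this, h0]
  | mod ws =>
    -- By Fermat a MOD gate costs no error, and its degree factor `p - 1` is within the allowed `T *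
    -- (p - 1)`.
    refine ⟨(fun x => (ws.map fun w => q w x).sum) ^ (p - 1), ?_, exact_case _ _ ?_⟩
    · refine lowDegree_mono ?_ (pow_mem_lowDegree (listSum_mem_lowDegree q _ ws (hmem ws)) _)
      rw [CircuitGate.depth, ← hdeg]
      exact Nat.le_mul_of_pos_left _ hT
    · intro x hx
      simp only [Pi.pow_apply, hx, sum_boolVal_eq_countP, CircuitGate.eval]
      by_cases h : p ∣ ws.countP (v x)
      · simp [(ZMod.natCast_eq_zero_iff _ _).2 h, h, hp.ne']
      · rw [ZMod.pow_card_sub_one_eq_one (fun h0 => h ((ZMod.natCast_eq_zero_iff _ _).1 h0))]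
        simp [h]

/-- Union bound in topological order: a bad input is charged to the first gate whose polynomial
errs, where all wires are still right. Shared gates are charged once, so size rather than formula
size appears. -/
theorem CircuitNodes.exists_lowDegree_approx (T : ℕ) (hT : 1 ≤ T) {t : ℕ} (N : CircuitNodes n t) :
    ∃ q : Fin t → (Fin n → Bool) → ZMod p,
      (∀ j, q j ∈ lowDegree (ZMod p) n ((T * (p - 1)) ^ N.depth j)) ∧
      (Finset.univ.filter fun x => ∃ j, q j x ≠ boolVal (ZMod p) (N.val p x j)).card * 2 ^ T ≤
        N.size * 2 ^ n := by
  induction N with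
  | nil => exact ⟨Fin.elim0, fun j => j.elim0, by simp⟩
  | @snoc t N g ih =>
    obtain ⟨q, hq, hbad⟩ := ih
    obtain ⟨r, hr, hrbad⟩ := g.exists_lowDegree_approx (p := p)
      (fun x => Sum.elim x (N.val p x)) (Sum.elim (fun _ => 0) N.depth)
      (Sum.elim (fun i x => boolVal (ZMod p) (x i)) q) T hT (by
        rintro (i | j)
        · exact coord_mem_lowDegree (by simp) i
        · exact hq j)
    refine ⟨Fin.snoc (α := fun _ => (Fin n → Bool) → ZMod p) q r, ?_, ?_⟩
    · intro j
      refine Fin.lastCases ?_ (fun j => ?_) j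
      · simpa [CircuitNodes.depth] using hr
      · simpa [CircuitNodes.depth] using hq j
    · rw [CircuitNodes.size, add_mul]
      refine le_trans ?_ (add_le_add hbad hrbad)
      rw [← add_mul]
      refine Nat.mul_le_mul_right _ (le_trans (Finset.card_le_card fun x => ?_)
        (Finset.card_union_le _ _))
      simp only [Finset.mem_filter, Finset.mem_univ, true_and, Finset.mem_union]
      rintro ⟨j, hj⟩
      by_cases hx : ∃ j, q j x ≠ boolVal (ZMod p) (N.val p x j)
      · exact Or.inl hx
      · push Not at hx
        refine Or.inr ⟨?_, ?_⟩
        · rintro (i | j)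
          · rfl
          · exact hx j
        · revert hj
          refine Fin.lastCases (fun hj => ?_) (fun j hj => ?_) j
          · simpa [CircuitNodes.val] using hj
          · exact absurd (hx j) (by simpa [CircuitNodes.val] using hj)

theorem ModCircuit.exists_lowDegree_approx (T : ℕ) (hT : 1 ≤ T) (C : ModCircuit n) :
    ∃ q ∈ lowDegree (ZMod p) n ((T * (p - 1)) ^ C.depth),
      (Finset.univ.filter fun x => q x ≠ boolVal (ZMod p) (C.eval p x)).card * 2 ^ T ≤
        C.size * 2 ^ n := by
  obtain ⟨t, N, out⟩ := C
  obtain ⟨q, hq, hbad⟩ := N.exists_lowDegree_approx (p := p) T hT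
  rcases out with i | j
  · exact ⟨_, coord_mem_lowDegree (by simp [ModCircuit.depth]) i, by simp [ModCircuit.eval]⟩
  · refine ⟨q j, hq j, (Nat.mul_le_mul_right _ (Finset.card_le_card fun x => ?_)).trans hbad⟩
    simp only [Finset.mem_filter, Finset.mem_univ, true_and]
    exact fun h => ⟨j, h⟩

end Approximation

/-! ### Circuits with at most one gate -/

section SmallCircuits

variable {n : ℕ}

/-- The input `x` with its `i`-th bit flipped. -/
def flipBit (i : Fin n) (x : Fin n → Bool) : Fin n → Bool := Function.update x i (!(x i))

/-- A constant or a literal. -/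
def IsLiteralOrConst (h : (Fin n → Bool) → Bool) : Prop :=
  (∃ c, ∀ x, h x = c) ∨ ∃ i b, ∀ x, h x = (x i ^^ b)

/-- `h` is constant, or it takes some value on no edge of some direction of the cube. -/
def AvoidsEdges (h : (Fin n → Bool) → Bool) : Prop :=
  (∃ c, ∀ x, h x = c) ∨ ∃ i b, ∀ x, ¬ (h x = b ∧ h (flipBit i x) = b)

theorem IsLiteralOrConst.not {h : (Fin n → Bool) → Bool} (hh : IsLiteralOrConst h) :
    IsLiteralOrConst fun x => !(h x) := by
  rcases hh with ⟨c, hc⟩ | ⟨i, b, hb⟩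
  · exact Or.inl ⟨!c, fun x => by simp [hc]⟩
  · exact Or.inr ⟨i, !b, fun x => by simp [hb]⟩

theorem AvoidsEdges.not {h : (Fin n → Bool) → Bool} (hh : AvoidsEdges h) :
    AvoidsEdges fun x => !(h x) := by
  rcases hh with ⟨c, hc⟩ | ⟨i, b, hb⟩
  · exact Or.inl ⟨!c, fun x => by simp [hc]⟩
  · refine Or.inr ⟨i, !b, fun x hx => hb x ?_⟩
    simpa using hx

theorem IsLiteralOrConst.avoidsEdges {h : (Fin n → Bool) → Bool} (hh : IsLiteralOrConst h) :
    AvoidsEdges h := by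
  rcases hh with hc | ⟨i, b, hb⟩
  · exact Or.inl hc
  · refine Or.inr ⟨i, true, fun x hx => ?_⟩
    simp only [hb, flipBit, Function.update_self] at hx
    revert hx
    cases x i <;> cases b <;> simp

/-- Single flips join any two points; coordinates of `x` are replaced by those of `y` one at a time.
-/
theorem eq_of_flipBit_invariant {β : Type*} {L : (Fin n → Bool) → β}
    (hL : ∀ i x, L (flipBit i x) = L x) (x y : Fin n → Bool) : L x = L y := by
  classical
  have h : ∀ s : Finset (Fin n), L (s.piecewise y x) = L x := by
    intro s
    induction s using Finset.induction_on with
    | empty => simp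
    | insert a s ha ih =>
      rw [Finset.piecewise_insert]
      by_cases hxy : y a = x a
      · rw [← ih]
        congr 1
        refine Function.update_eq_self_iff.2 ?_
        simp [ha, hxy]
      · rw [← ih, ← hL a (s.piecewise y x)]
        congr 1
        rw [flipBit, Finset.piecewise_eq_of_notMem _ _ _ ha]
        congr 1
        revert hxy
        cases y a <;> cases x a <;> simp
  have := h Finset.univ
  rw [Finset.piecewise_univ] at this
  exact this.symm

/-- If some input is a nonconstant literal, flipping its variable falsifies it, so the AND cannot be
true at both ends. -/
theorem avoidsEdges_all {W : Type} (v : (Fin n → Bool) → W → Bool)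
    (hv : ∀ w, IsLiteralOrConst fun x => v x w) (ws : List W) :
    AvoidsEdges fun x => ws.all (v x) := by
  by_cases hc : ∀ w ∈ ws, ∃ c, ∀ x, v x w = c
  · refine Or.inl ⟨ws.all (v fun _ => false), fun x => ?_⟩
    rw [Bool.eq_iff_iff, List.all_eq_true, List.all_eq_true]
    refine forall₂_congr fun w hw => ?_
    obtain ⟨c, hc⟩ := hc w hw
    rw [hc, hc]
  · push Not at hc
    obtain ⟨w, hw, hne⟩ := hc
    rcases hv w with ⟨c, hc⟩ | ⟨i, b, hb⟩
    · obtain ⟨x, hx⟩ := hne c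
      exact absurd (hc x) hx
    · refine Or.inr ⟨i, true, fun x hx => ?_⟩
      simp only [List.all_eq_true] at hx
      have h1 := hx.1 w hw
      have h2 := hx.2 w hw
      simp only [hb] at h1 h2
      rw [flipBit, Function.update_self] at h2
      revert h1 h2
      cases x i <;> cases b <;> simp

theorem avoidsEdges_any {W : Type} (v : (Fin n → Bool) → W → Bool)
    (hv : ∀ w, IsLiteralOrConst fun x => v x w) (ws : List W) :
    AvoidsEdges fun x => ws.any (v x) := by
  have h := (avoidsEdges_all (fun x w => !(v x w)) (fun w => (hv w).not) ws).not
  have he : (fun x => ws.any (v x)) = fun x => !(ws.all fun w => !(v x w)) := by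
    funext x
    rw [List.not_all_eq_any_not]
    simp
  rw [he]
  exact h

/-- Modulo `p` the count is affine in the bits, so flipping bit `i` changes it by `±a` with `a`
independent of `x`. Either every such change is zero and the gate is constant, or for some `i` the
count is never zero at both ends of an edge. -/
theorem avoidsEdges_mod {p : ℕ} [Fact p.Prime] {W : Type} (v : (Fin n → Bool) → W → Bool)
    (hv : ∀ w, IsLiteralOrConst fun x => v x w) (ws : List W) :
    AvoidsEdges fun x => decide (¬ p ∣ ws.countP (v x)) := by
  have hlin : ∀ i, ∃ a : ZMod p, ∀ x, (ws.countP (v (flipBit i x)) : ZMod p) =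
      ws.countP (v x) + a * (if x i then -1 else 1) := by
    intro i
    induction ws with
    | nil => exact ⟨0, by simp⟩
    | cons w ws ih =>
      obtain ⟨a, ha⟩ := ih
      have hw : ∃ a' : ZMod p, ∀ x, boolVal (ZMod p) (v (flipBit i x) w) =
          boolVal (ZMod p) (v x w) + a' * (if x i then -1 else 1) := by
        rcases hv w with ⟨c, hc⟩ | ⟨j, b, hb⟩
        · exact ⟨0, fun x => by simp [hc]⟩
        · replace hb : ∀ x, v x w = (x j ^^ b) := hb
          by_cases hij : j = i
          · subst hij
            refine ⟨if b then -1 else 1, fun x => ?_⟩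
            rw [hb, hb, flipBit, Function.update_self]
            cases x j <;> cases b <;> simp
          · refine ⟨0, fun x => ?_⟩
            rw [hb, hb, flipBit, Function.update_of_ne hij]
            simp
      obtain ⟨a', ha'⟩ := hw
      refine ⟨a' + a, fun x => ?_⟩
      simp only [← sum_boolVal_eq_countP] at ha ⊢
      rw [List.map_cons, List.sum_cons, List.map_cons, List.sum_cons, ha, ha']
      ring
  by_cases h0 : ∀ i x, (ws.countP (v (flipBit i x)) : ZMod p) = ws.countP (v x)
  · refine Or.inl ⟨decide (¬ p ∣ ws.countP (v fun _ => false)), fun x => ?_⟩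
    simp only [← ZMod.natCast_eq_zero_iff]
    rw [eq_of_flipBit_invariant (L := fun x => (ws.countP (v x) : ZMod p)) h0 x fun _ => false]
  · push Not at h0
    obtain ⟨i, y, hy⟩ := h0
    obtain ⟨a, ha⟩ := hlin i
    refine Or.inr ⟨i, false, fun x hx => hy ?_⟩
    simp only [decide_eq_false_iff_not, not_not, ← ZMod.natCast_eq_zero_iff] at hx
    have hx' := ha x
    rw [hx.1, hx.2, zero_add] at hx'
    have ha0 : a = 0 := by
      revert hx'
      cases x i <;> simp [eq_comm]
    rw [ha y, ha0]
    simp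

theorem CircuitNodes.isLiteralOrConst_of_size_eq_zero (p : ℕ) {t : ℕ} (N : CircuitNodes n t)
    (hN : N.size = 0) (w : Fin n ⊕ Fin t) :
    IsLiteralOrConst fun x => Sum.elim x (N.val p x) w := by
  rcases w with i | j
  · exact Or.inr ⟨i, false, fun x => by simp⟩
  induction N with
  | nil => exact j.elim0
  | @snoc t N g ih =>
    rw [CircuitNodes.size, Nat.add_eq_zero_iff] at hN
    have hw : ∀ w, IsLiteralOrConst fun x => Sum.elim x (N.val p x) w := by
      rintro (i | j)
      · exact Or.inr ⟨i, false, fun x => by simp⟩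
      · exact ih hN.1 j
    refine Fin.lastCases ?_ (fun j => ?_) j
    · simp only [Sum.elim_inr, CircuitNodes.val, Fin.snoc_last]
      cases g with
      | const a => exact Or.inl ⟨a, fun _ => rfl⟩
      | not w => exact (hw w).not
      | _ => simp [CircuitGate.cost] at hN
    · simpa [CircuitNodes.val] using ih hN.1 j

/-- The only costly gate reads constants and literals, and negations preserve `AvoidsEdges`. -/
theorem CircuitNodes.avoidsEdges_of_size_le_one (p : ℕ) [Fact p.Prime] {t : ℕ} (N : CircuitNodes n t)
    (hN : N.size ≤ 1) (w : Fin n ⊕ Fin t) :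
    AvoidsEdges fun x => Sum.elim x (N.val p x) w := by
  have hinput : ∀ i : Fin n, AvoidsEdges fun x => x i := fun i =>
    IsLiteralOrConst.avoidsEdges (Or.inr ⟨i, false, fun x => by simp⟩)
  rcases w with i | j
  · exact hinput i
  induction N with
  | nil => exact j.elim0
  | @snoc t N g ih =>
    rw [CircuitNodes.size] at hN
    refine Fin.lastCases ?_ (fun j => ?_) j
    · simp only [Sum.elim_inr, CircuitNodes.val, Fin.snoc_last]
      cases g with
      | const a => exact Or.inl ⟨a, fun _ => rfl⟩
      | not w =>
        rcases w with i | j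
        · exact (hinput i).not
        · exact (ih (by omega) j).not
      | and ws =>
        exact avoidsEdges_all _ (N.isLiteralOrConst_of_size_eq_zero p
          (by simp [CircuitGate.cost] at hN; exact hN)) ws
      | or ws =>
        exact avoidsEdges_any _ (N.isLiteralOrConst_of_size_eq_zero p
          (by simp [CircuitGate.cost] at hN; exact hN)) ws
      | mod ws =>
        exact avoidsEdges_mod _ (N.isLiteralOrConst_of_size_eq_zero p
          (by simp [CircuitGate.cost] at hN; exact hN)) ws
    · simpa [CircuitNodes.val] using ih (by omega) j

end SmallCircuits

/-! ### The lower bound -/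

section LowerBound

/-- Each value of the feasibility function is missed on some pattern of signs on any `k + 1` of the
`2 k + 1` hyperplanes. -/
theorem HyperplaneArrangement.InGeneralPosition.exists_feasibilityFn_ne {k : ℕ}
    {H : HyperplaneArrangement k (2 * k + 1)} (hH : H.InGeneralPosition) (b : Bool)
    (I : Finset (Fin (2 * k + 1))) (hI : I.card = k + 1) :
    ∃ a : Fin (2 * k + 1) → Bool, ∀ s, (∀ i ∈ I, s i = a i) → H.feasibilityFn s ≠ b := by
  classical
  cases b
  · obtain ⟨a, ha⟩ := hH.exists_feasible_pattern Iᶜ (by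
      rw [Finset.card_compl, hI, Fintype.card_fin]; omega)
    refine ⟨a, fun s hs => ?_⟩
    have := ha s fun i hi => hs i (by simpa using hi)
    simp [HyperplaneArrangement.feasibilityFn, this]
  · obtain ⟨a, ha⟩ := H.exists_infeasible_pattern I hI
    refine ⟨a, fun s hs => ?_⟩
    simp [HyperplaneArrangement.feasibilityFn, ha s hs]

/-- Since `2k ≥ k + 1`, some `k + 1` coordinates omit direction `i`; a pattern on them forces either
chosen value at both ends of an edge in that direction. -/
theorem not_avoidsEdges {k : ℕ} (hk : 1 ≤ k) (f : (Fin (2 * k + 1) → Bool) → Bool)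
    (hf : ∀ b, ∀ I : Finset (Fin (2 * k + 1)), I.card = k + 1 →
      ∃ a : Fin (2 * k + 1) → Bool, ∀ s, (∀ i ∈ I, s i = a i) → f s ≠ b) :
    ¬ AvoidsEdges f := by
  have hI : ∀ i : Fin (2 * k + 1), ∃ I : Finset (Fin (2 * k + 1)), i ∉ I ∧ I.card = k + 1 := by
    intro i
    obtain ⟨I, hI, hc⟩ := Finset.exists_subset_card_eq
      (s := (Finset.univ : Finset (Fin (2 * k + 1))).erase i) (n := k + 1) (by
        rw [Finset.card_erase_of_mem (Finset.mem_univ i), Finset.card_univ, Fintype.card_fin]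
        omega)
    exact ⟨I, fun h => by simpa using hI h, hc⟩
  rintro (⟨c, hc⟩ | ⟨i, b, hb⟩)
  · obtain ⟨I, -, hI⟩ := hI 0
    obtain ⟨a, ha⟩ := hf c I hI
    exact ha a (fun _ _ => rfl) (hc a)
  · obtain ⟨I, hiI, hI⟩ := hI i
    obtain ⟨a, ha⟩ := hf (!b) I hI
    refine hb a ⟨by simpa using ha a fun _ _ => rfl, ?_⟩
    have := ha (flipBit i a) fun j hj => by
      rw [flipBit, Function.update_of_ne]
      rintro rfl
      exact hiI hj
    simpa using this

theorem ModCircuit.two_pow_le_size {p : ℕ} [Fact p.Prime] {k d T : ℕ} (hT : 1 ≤ T)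
    (hTk : (4 * (T * (p - 1)) ^ d) ^ 2 ≤ 2 * k + 3) (f : (Fin (2 * k + 1) → Bool) → Bool)
    (hf : ∀ b, ∀ I : Finset (Fin (2 * k + 1)), I.card = k + 1 →
      ∃ a : Fin (2 * k + 1) → Bool, ∀ s, (∀ i ∈ I, s i = a i) → f s ≠ b)
    (C : ModCircuit (2 * k + 1)) (hd : C.depth ≤ d) (hC : C.Computes p f) :
    2 ^ T ≤ 4 * C.size := by
  classical
  have hp : 0 < p - 1 := by have := (Fact.out : p.Prime).two_le; omega
  obtain ⟨q, hq, hbad⟩ := C.exists_lowDegree_approx (p := p) T hT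
  have hq' := lowDegree_mono (Nat.pow_le_pow_right (Nat.mul_pos hT hp) hd) hq
  have hgood := card_agreement_le f hf hq'
    (Finset.univ.filter fun x => q x = boolVal (ZMod p) (f x)) (by simp)
  have hsum := Finset.card_filter_add_card_filter_not
    (s := (Finset.univ : Finset (Fin (2 * k + 1) → Bool)))
    (fun x => q x = boolVal (ZMod p) (f x))
  simp only [hC _] at hbad
  have hchoose := four_mul_choose_le hTk
  have hcard : (Finset.univ : Finset (Fin (2 * k + 1) → Bool)).card = 2 ^ (2 * k + 1) := by simp
  rw [hcard] at hsum
  have h4 : 2 * 4 ^ k = 2 ^ (2 * k + 1) := by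
    rw [pow_succ, pow_mul, mul_comm]; norm_num
  -- Agreement covers at most a half plus a quarter of the cube, so `q` errs on at least a quarter.
  have hbig : 2 ^ (2 * k + 1) ≤ 4 * (Finset.univ.filter
      fun x => ¬ q x = boolVal (ZMod p) (f x)).card := by omega
  refine Nat.le_of_mul_le_mul_right (?_ : _ * 2 ^ (2 * k + 1) ≤ _ * 2 ^ (2 * k + 1))
    (by positivity)
  calc 2 ^ T * 2 ^ (2 * k + 1) ≤ 2 ^ T * (4 * (Finset.univ.filter
      fun x => ¬ q x = boolVal (ZMod p) (f x)).card) := Nat.mul_le_mul_left _ hbig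
    _ = 4 * ((Finset.univ.filter
      fun x => ¬ q x = boolVal (ZMod p) (f x)).card * 2 ^ T) := by ring
    _ ≤ 4 * (C.size * 2 ^ (2 * k + 1)) := Nat.mul_le_mul_left _ hbad
    _ = 4 * C.size * 2 ^ (2 * k + 1) := by ring

end LowerBound

theorem theorem1 (p : ℕ) (hp : p.Prime) :
    ∃ c : ℝ, 0 < c ∧
      ∀ d : ℕ, 1 ≤ d → ∀ k : ℕ, 1 ≤ k →
        ∀ H : HyperplaneArrangement k (2 * k + 1), H.InGeneralPosition →
          ∀ C : ModCircuit (2 * k + 1), C.depth ≤ d → C.Computes p H.feasibilityFn →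
            Real.exp (c * (k : ℝ) ^ (1 / (2 * (d : ℝ)))) ≤ (C.size : ℝ) := by
  have : Fact p.Prime := ⟨hp⟩
  have hp1 : 0 < p - 1 := by have := hp.two_le; omega
  have hP : (0 : ℝ) < ((p - 1 : ℕ) : ℝ) := by exact_mod_cast hp1
  -- A factor `4 * (p - 1)` makes `T = ⌊Y⌋₊` satisfy the degree condition; a further 4 absorbs the
  -- rounding and the loss `2 ^ 2` in `two_pow_le_size`.
  refine ⟨Real.log 2 / (16 * ((p - 1 : ℕ) : ℝ)),
    div_pos (Real.log_pos one_lt_two) (by positivity), ?_⟩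
  intro d hd k hk H hH C hCd hC
  have hf := hH.exists_feasibilityFn_ne
  set X : ℝ := (k : ℝ) ^ (1 / (2 * (d : ℝ))) with hX
  have hX0 : 0 ≤ X := by positivity
  have hXk : X ^ (2 * d) = k := by
    rw [hX, ← Real.rpow_natCast, ← Real.rpow_mul (by positivity)]
    have : (d : ℝ) ≠ 0 := by positivity
    rw [show 1 / (2 * (d : ℝ)) * ((2 * d : ℕ) : ℝ) = 1 by push_cast; field_simp, Real.rpow_one]
  set Y : ℝ := X / (4 * ((p - 1 : ℕ) : ℝ)) with hY
  have hY0 : 0 ≤ Y := by positivity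
  have hexp : Real.exp (Real.log 2 / (16 * ((p - 1 : ℕ) : ℝ)) * X) = (2 : ℝ) ^ (Y / 4) := by
    rw [Real.rpow_def_of_pos two_pos, hY]
    congr 1
    field_simp
    ring
  rw [hexp]
  -- The threshold 4 serves both cases: below it the target is at most 2, and from it on `Y / 4 + 2
  -- ≤ Y - 1 < ⌊Y⌋₊`.
  rcases lt_or_ge Y 4 with hY4 | hY4
  · have hsize : 2 ≤ C.size := by
      by_contra hcon
      refine not_avoidsEdges hk _ hf ?_
      have h := C.nodes.avoidsEdges_of_size_le_one p
        (show C.nodes.size ≤ 1 by rw [ModCircuit.size] at hcon; omega) C.out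
      have he : (fun x => Sum.elim x (C.nodes.val p x) C.out) = H.feasibilityFn := funext hC
      rwa [he] at h
    calc (2 : ℝ) ^ (Y / 4) ≤ 2 ^ (1 : ℝ) :=
        Real.rpow_le_rpow_of_exponent_le one_le_two (by linarith)
      _ = 2 := Real.rpow_one 2
      _ ≤ C.size := by exact_mod_cast hsize
  · have hT1 : (⌊Y⌋₊ : ℝ) ≤ Y := Nat.floor_le hY0
    have hT2 : Y < ⌊Y⌋₊ + 1 := Nat.lt_floor_add_one Y
    have hT : 1 ≤ ⌊Y⌋₊ := Nat.le_floor (by push_cast; linarith)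
    have hTk : (4 * (⌊Y⌋₊ * (p - 1)) ^ d) ^ 2 ≤ 2 * k + 3 := by
      have h1 : (4 * (⌊Y⌋₊ * (p - 1)) ^ d) ^ 2 ≤ (4 * (⌊Y⌋₊ * (p - 1))) ^ (2 * d) := by
        rw [mul_comm 2 d, pow_mul, mul_pow 4 _ d]
        gcongr
        exact Nat.le_self_pow (by omega) 4
      have h2 : ((4 * (⌊Y⌋₊ * (p - 1)) : ℕ) : ℝ) ≤ X := by
        have : Y * (4 * ((p - 1 : ℕ) : ℝ)) = X := by rw [hY]; field_simp
        rw [← this, Nat.cast_mul, Nat.cast_mul]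
        push_cast
        nlinarith
      have h3 : (((4 * (⌊Y⌋₊ * (p - 1))) ^ (2 * d) : ℕ) : ℝ) ≤ k := by
        rw [← hXk, Nat.cast_pow]
        gcongr
      have h4 : (4 * (⌊Y⌋₊ * (p - 1))) ^ (2 * d) ≤ k := by exact_mod_cast h3
      omega
    have hmain : (2 : ℝ) ^ ⌊Y⌋₊ ≤ 4 * C.size := by
      exact_mod_cast C.two_pow_le_size hT hTk _ hf hCd hC
    have h5 : (2 : ℝ) ^ (Y / 4 + 2) ≤ (2 : ℝ) ^ (⌊Y⌋₊ : ℝ) :=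
      Real.rpow_le_rpow_of_exponent_le one_le_two (by linarith)
    rw [Real.rpow_add two_pos, Real.rpow_natCast, Real.rpow_two] at h5
    linarith
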